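/- Let $\mathcal R$ be the Levi-Civita field: the functions $x:\mathbb Q\to\mathbb R$ whose support is left-finite (finitely many elements below every bound), with pointwise sum, convolution product, and $x<y$ iff $x(q)<y(q)$ at the least $q$ with $x(q)\neq y(q)$. Let $\mathcal R_{fin}=\{x\in\mathcal R:\exists s\in\mathbb R,\ |x|<s\}$, and for $x\in\mathcal R$ let ${}^\circ x=\sup\{z\in\mathbb R: z\le x\}\in[-\infty,+\infty]$ be its standard part. *Non-Archimedean measure and integral.* Intervals are bounded (possibly degenerate), with or without endpoints, and $l$ is their length. A set $A\subseteq\mathcal R$ is measurable if for every $\varepsilon>0$ in $\mathcal R$ there are sequences of mutually disjoint intervals $(I_n)$, $(J_n)$ with $\bigcup I_n\subseteq A\subseteq\bigcup J_n$ whose total lengths converge in the order topology and differ by at most $\varepsilon$; its measure $m(A)$ is the supremum of the total lengths of such inner sequences, which is the infimum of the total lengths of such outer sequences. A sequence $(c_k)$ in $\mathcal R$ converges weakly to $l$ if for every real $\varepsilon>0$ one has, for all large $k$, $|(c_k-l)(q)|<\varepsilon$ for every rational $q\le\varepsilon^{-1}$. A function is simple on an interval if there it is the weak sum of a power series $\sum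 a_n(x-x_0)^n$ with $a_n,x_0\in\mathcal R$; its integral over an interval with endpoints $a<b$ is $\lim_{x\to b}F-\lim_{x\to a}F$, with $F$ a simple antiderivative (and $0$ over a degenerate interval). A function $f:A\to\mathcal R$ on a measurable set $A$ is measurable if for every $\varepsilon>0$ in $\mathcal R$ there are mutually disjoint intervals $I_n\subseteq A$ with $\sum l(I_n)$ convergent, $m(A)-\sum l(I_n)<\varepsilon$ and $f$ simple on each $I_n$; then $\int_A f$ is the limit, if it exists, of $\sum_n\int_{I_n}f$ over the sequences of disjoint intervals $I_n\subseteq A$ on which $f$ is simple, as $\sum l(I_n)\to m(A)$. $\mathcal L^1(A)$ is the set of measurable $f$ for which $\int_A|f|$ is defined in $\mathcal R$. *M-integral.* Let $A$ be measurable, $f:A\to\mathcal R$. Put $L(f)=\sup\{{}^\circ(\int_A g): g\in\mathcal L^1(A),\ g\le f \text{ on } A\}$ and $U(f)=\inf\{{}^\circ(\int_A g): g\in\mathcal L^1(A),\ g\ge f\text{ on }A\}$ in $[-\infty,+\infty]$. If $f$ is bounded (by an element of $\mathcal R$), $f$ is M-integrable iff $L(f)=U(f)$, and then $\int^M_A f=L(f)$.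 If $f$ is unbounded and non-negative, $f$ is M-integrable iff $L(f)<+\infty$, and then $\int_A^M f=L(f)$. If $f$ is unbounded and non-positive, it is M-integrable iff $f^-$ is, with $\int^M_A f=-\int^M_A f^-$. Any other unbounded $f$ is M-integrable iff $f^+$ and $f^-$ are, with $\int_A^M f=\int_A^M f^+-\int_A^M f^-$. A function $f:\mathcal R_{fin}\to\mathcal R$ is M-integrable if it is M-integrable on $[-t,t]_{\mathcal R}$ for all large real $t$ and $\lim_{t\to+\infty}\int^M_{[-t,t]_{\mathcal R}}f$ exists finite in $\mathbb R$; this limit is $\int^M_{\mathcal R_{fin}}f$. *Dirac-like functions.* An M-integrable function $\delta_r:\mathcal R_{fin}\to\mathcal R$ is Dirac-like at $r\in\mathcal R_{fin}$ if $\delta_r(x)\ge 0$ for all $x\in\mathcal R_{fin}$, there is an infinitesimal $h>0$ such that $\operatorname{supp}\delta_r\subseteq[r-h,r+h]_{\mathcal R}\subseteq\mathcal R_{fin}$, and $\int^M_{\mathcal R_{fin}}\delta_r=1$. For a continuous $f:\mathbb R\to\mathbb R$, let $\mathrm{ext}_0 f:\mathcal R_{fin}\to\mathcal R$ be defined by $\mathrm{ext}_0f(s+\varepsilon)=f(s)$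 for $s\in\mathbb R$ and $\varepsilon$ infinitesimal (possibly zero). **Proposition.** Let $r\in\mathbb R$. For every M-integrable function $\delta_r:\mathcal R_{fin}\to\mathcal R$ that is Dirac-like at $r$ and every $f\in C^0(\mathbb R)$, the function $\delta_r\cdot\mathrm{ext}_0 f$ is M-integrable over $\mathcal R_{fin}$ and $$\int^M_{\mathcal R_{fin}}\bigl(\delta_r\cdot\mathrm{ext}_0f\bigr)=f(r).$$ -/

import Mathlib

open Filter Topology

noncomputable section

/-! ### The Levi-Civita field -/

/-- A set of rational numbers is left-finite if it has finitely many elements below every bound. -/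
def IsLeftFinite (S : Set ℚ) : Prop := ∀ q : ℚ, (S ∩ Set.Iic q).Finite

theorem IsLeftFinite.mono {S T : Set ℚ} (hT : IsLeftFinite T) (h : S ⊆ T) : IsLeftFinite S :=
  fun q => (hT q).subset (Set.inter_subset_inter_left _ h)

theorem IsLeftFinite.union {S T : Set ℚ} (hS : IsLeftFinite S) (hT : IsLeftFinite T) :
    IsLeftFinite (S ∪ T) := fun q => by
  rw [Set.union_inter_distrib_right]
  exact (hS q).union (hT q)

theorem isLeftFinite_singleton (a : ℚ) : IsLeftFinite {a} :=
  fun _ => (Set.finite_singleton a).subset Set.inter_subset_left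

theorem IsLeftFinite.bddBelow {S : Set ℚ} (hS : IsLeftFinite S) : BddBelow S := by
  obtain ⟨b, hb⟩ := (hS 0).bddBelow
  refine ⟨min b 0, fun s hs => ?_⟩
  rcases le_total s 0 with h | h
  · exact (min_le_left _ _).trans (hb ⟨hs, h⟩)
  · exact (min_le_right _ _).trans h

open scoped Pointwise in
theorem IsLeftFinite.add {S T : Set ℚ} (hS : IsLeftFinite S) (hT : IsLeftFinite T) :
    IsLeftFinite (S + T) := by
  intro q
  obtain ⟨a, ha⟩ := hS.bddBelow
  obtain ⟨b, hb⟩ := hT.bddBelow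
  refine ((hS (q - b)).add (hT (q - a))).subset ?_
  rintro _ ⟨⟨s, hs, t, ht, rfl⟩, hq⟩
  have h1 := ha hs
  have h2 := hb ht
  have h3 : s + t ≤ q := hq
  refine ⟨s, ⟨hs, ?_⟩, t, ⟨ht, ?_⟩, rfl⟩ <;> simp only [Set.mem_Iic] <;> linarith

/-- The functions `ℚ → ℝ` with left-finite support, inside the Hahn series (the functions `ℚ → ℝ`
with well-ordered support), with pointwise sum and convolution product. -/
def leviCivitaSubring : Subring (HahnSeries ℚ ℝ) where
  carrier := {x | IsLeftFinite x.support}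
  mul_mem' {x y} hx hy :=
    (IsLeftFinite.add hx hy).mono HahnSeries.support_mul_subset
  one_mem' := (isLeftFinite_singleton 0).mono HahnSeries.support_single_subset
  add_mem' {x y} hx hy := (IsLeftFinite.union hx hy).mono (HahnSeries.support_add_subset _ _)
  zero_mem' := fun q => by simp
  neg_mem' {x} hx := by
    change IsLeftFinite (HahnSeries.support (-x))
    rw [HahnSeries.support_neg]
    exact hx

/-- The Levi-Civita field. -/
def LeviCivita : Type := leviCivitaSubring

namespace LeviCivita

instance : CommRing LeviCivita := inferInstanceAs (CommRing leviCivitaSubring)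

/-- The value `x(q)` of the function `x : ℚ → ℝ`. -/
def coeff (x : LeviCivita) (q : ℚ) : ℝ := HahnSeries.coeff x.1 q

/-- The order of the Levi-Civita field: `x < y` iff `x(q) < y(q)` at the least `q` with
`x(q) ≠ y(q)`. -/
instance : LinearOrder LeviCivita :=
  LinearOrder.lift' (fun x : LeviCivita => (toLex x.1 : Lex (HahnSeries ℚ ℝ)))
    (fun _ _ h => Subtype.ext (toLex.injective h))

theorem lt_iff (x y : LeviCivita) :
    x < y ↔ ∃ q : ℚ, (∀ p < q, x.coeff p = y.coeff p) ∧ x.coeff q < y.coeff q := Iff.rfl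

/-- The embedding of the real numbers. -/
def ofReal : ℝ →+* LeviCivita :=
  RingHom.codRestrict (HahnSeries.C : ℝ →+* HahnSeries ℚ ℝ) leviCivitaSubring
    (fun _ => (isLeftFinite_singleton 0).mono HahnSeries.support_single_subset)

/-- The finite elements. -/
def finiteSet : Set LeviCivita := {x | ∃ r : ℝ, |x| < ofReal r}

/-- Infinitesimal elements (zero included). -/
def IsInfinitesimal (x : LeviCivita) : Prop := ∀ r : ℝ, 0 < r → |x| ≤ ofReal r

/-- The standard part `sup {z ∈ ℝ : z ≤ x}`; it is `+∞` at positive infinite elements and `-∞` at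
negative infinite elements. -/
def sh (x : LeviCivita) : EReal := sSup {z : EReal | ∃ r : ℝ, z = (r : EReal) ∧ ofReal r ≤ x}

/-! ### Convergence, power series, simple functions -/

/-- The series `∑ a n` strongly converges (in the order topology) to `s`. -/
def HasStrongSum (a : ℕ → LeviCivita) (s : LeviCivita) : Prop :=
  ∀ ε : LeviCivita, 0 < ε → ∃ n : ℕ, ∀ m > n, |(∑ i ∈ Finset.range (m + 1), a i) - s| < ε

/-- Weak convergence of a sequence. -/
def WeakLim (c : ℕ → LeviCivita) (l : LeviCivita) : Prop :=
  ∀ ε : ℝ, 0 < ε → ∃ n : ℕ, ∀ m > n, ∀ q : ℚ, (q : ℝ) ≤ ε⁻¹ → |(c m - l).coeff q| < ε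

/-- `f` is simple on `S`: there it is the (weak) sum of a power series that weakly converges at
every point of `S`. -/
def IsSimpleOn (f : LeviCivita → LeviCivita) (S : Set LeviCivita) : Prop :=
  ∃ (a : ℕ → LeviCivita) (x₀ : LeviCivita), ∀ x ∈ S,
    WeakLim (fun k => ∑ n ∈ Finset.range (k + 1), a n * (x - x₀) ^ n) (f x)

/-- A bounded interval, with or without its endpoints `left ≤ right`. -/
structure BddInterval where
  left : LeviCivita
  right : LeviCivita
  left_le_right : left ≤ right
  toSet : Set LeviCivita
  toSet_eq : toSet = Set.Icc left right ∨ toSet = Set.Ico left right ∨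
    toSet = Set.Ioc left right ∨ toSet = Set.Ioo left right

/-- The length of an interval. -/
def BddInterval.length (I : BddInterval) : LeviCivita := I.right - I.left

/-- `F` has derivative `f` on `S`. -/
def HasDerivOn (F f : LeviCivita → LeviCivita) (S : Set LeviCivita) : Prop :=
  ∀ x ∈ S, ∀ ε : LeviCivita, 0 < ε → ∃ η : LeviCivita, 0 < η ∧
    ∀ y ∈ S, |y - x| < η → |F y - F x - f x * (y - x)| ≤ ε * |y - x|

/-- `F y` tends to `l` as `y → x`, `y ∈ S`. -/
def HasLimWithin (F : LeviCivita → LeviCivita) (S : Set LeviCivita) (x l : LeviCivita) : Prop :=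
  ∀ ε : LeviCivita, 0 < ε → ∃ η : LeviCivita, 0 < η ∧ ∀ y ∈ S, |y - x| < η → |F y - l| < ε

/-- The function `f`, simple on `I`, has integral `v` over `I`: `v` is the difference of the limits
at the endpoints of a simple antiderivative. The integral over a degenerate interval is zero. -/
def HasSimpleIntegral (I : BddInterval) (f : LeviCivita → LeviCivita) (v : LeviCivita) : Prop :=
  (I.left = I.right ∧ v = 0) ∨
  (I.left < I.right ∧ ∃ (F : LeviCivita → LeviCivita) (la lb : LeviCivita),
    IsSimpleOn F I.toSet ∧ HasDerivOn F f I.toSet ∧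
    HasLimWithin F I.toSet I.left la ∧ HasLimWithin F I.toSet I.right lb ∧ v = lb - la)

/-! ### The non-Archimedean uniform measure and integral -/

/-- The intervals `I n` are mutually disjoint and contained in `A`. -/
def InnerFamily (A : Set LeviCivita) (I : ℕ → BddInterval) : Prop :=
  Pairwise (fun i j => Disjoint (I i).toSet (I j).toSet) ∧ (⋃ n, (I n).toSet) ⊆ A

/-- The intervals `J n` are mutually disjoint and cover `A`. -/
def OuterFamily (A : Set LeviCivita) (J : ℕ → BddInterval) : Prop :=
  Pairwise (fun i j => Disjoint (J i).toSet (J j).toSet) ∧ A ⊆ ⋃ n, (J n).toSet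

/-- Measurable sets. -/
def IsMeasurableSet (A : Set LeviCivita) : Prop :=
  ∀ ε : LeviCivita, 0 < ε → ∃ (I J : ℕ → BddInterval) (s t : LeviCivita),
    InnerFamily A I ∧ OuterFamily A J ∧
    HasStrongSum (fun n => (I n).length) s ∧ HasStrongSum (fun n => (J n).length) t ∧ t - s ≤ ε

/-- The measurable set `A` has measure `m`. -/
def HasMeasure (A : Set LeviCivita) (m : LeviCivita) : Prop :=
  IsMeasurableSet A ∧
  IsLUB {s | ∃ I, InnerFamily A I ∧ HasStrongSum (fun n => (I n).length) s} m ∧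
  IsGLB {t | ∃ J, OuterFamily A J ∧ HasStrongSum (fun n => (J n).length) t} m

/-- `f` is a measurable function on the measurable set `A`. (Here and below only the values of `f`
on `A` matter.) -/
def IsMeasurableFun (A : Set LeviCivita) (f : LeviCivita → LeviCivita) : Prop :=
  ∃ m, HasMeasure A m ∧ ∀ ε : LeviCivita, 0 < ε → ∃ (I : ℕ → BddInterval) (s : LeviCivita),
    InnerFamily A I ∧ HasStrongSum (fun n => (I n).length) s ∧ m - s < ε ∧
    ∀ n, IsSimpleOn f (I n).toSet

/-- The measurable function `f` has integral `v` over `A`, where `v` is an element of the field: `v`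
is the limit of `∑ ∫_{I n} f` over the families of disjoint intervals `I n` in `A` on which `f` is
simple, as the total length of the family tends to the measure of `A`. -/
def HasIntegral (A : Set LeviCivita) (f : LeviCivita → LeviCivita) (v : LeviCivita) : Prop :=
  IsMeasurableFun A f ∧ ∃ m, HasMeasure A m ∧
    ∀ ε : LeviCivita, 0 < ε → ∃ η : LeviCivita, 0 < η ∧
      ∀ (I : ℕ → BddInterval) (s : LeviCivita), InnerFamily A I →
        (∀ n, IsSimpleOn f (I n).toSet) → HasStrongSum (fun n => (I n).length) s → m - s < η →
        ∃ (w : ℕ → LeviCivita) (W : LeviCivita),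
          (∀ n, HasSimpleIntegral (I n) f (w n)) ∧ HasStrongSum w W ∧ |W - v| < ε

/-- `f ∈ L¹(A)`: `f` is measurable and the integral of `|f|` is defined and is not `+∞`. -/
def MemL1 (A : Set LeviCivita) (f : LeviCivita → LeviCivita) : Prop :=
  IsMeasurableFun A f ∧ ∃ v, HasIntegral A (fun x => |f x|) v

/-! ### The real-valued integral -/

/-- The supremum of the standard parts of `∫_A g`, for `g ∈ L¹(A)` with `g ≤ f` on `A`. -/
def lowerM (A : Set LeviCivita) (f : LeviCivita → LeviCivita) : EReal :=
  sSup {z | ∃ g v, MemL1 A g ∧ (∀ x ∈ A, g x ≤ f x) ∧ HasIntegral A g v ∧ z = sh v}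

/-- The infimum of the standard parts of `∫_A g`, for `g ∈ L¹(A)` with `f ≤ g` on `A`. -/
def upperM (A : Set LeviCivita) (f : LeviCivita → LeviCivita) : EReal :=
  sInf {z | ∃ g v, MemL1 A g ∧ (∀ x ∈ A, f x ≤ g x) ∧ HasIntegral A g v ∧ z = sh v}

/-- `f` is bounded on `A` (by an element of the field). -/
def IsBddOn (A : Set LeviCivita) (f : LeviCivita → LeviCivita) : Prop :=
  ∃ M : LeviCivita, ∀ x ∈ A, |f x| ≤ M

/-- The positive part of a function. -/
def posPart (f : LeviCivita → LeviCivita) : LeviCivita → LeviCivita := fun x => max (f x) 0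

/-- The negative part of a function. -/
def negPart (f : LeviCivita → LeviCivita) : LeviCivita → LeviCivita := fun x => max (-f x) 0

/-- M-integrability of a non-negative function: equality of the lower and upper values if it is
bounded, finiteness of the lower value if it is unbounded. -/
def MIntegrableNonneg (A : Set LeviCivita) (f : LeviCivita → LeviCivita) : Prop :=
  (IsBddOn A f ∧ lowerM A f = upperM A f) ∨ (¬ IsBddOn A f ∧ lowerM A f < ⊤)

open Classical in
/-- M-integrability over a measurable set `A`; the cases are: bounded, unbounded and non-negative,
unbounded and non-positive, any other unbounded function. -/
def MIntegrable (A : Set LeviCivita) (f : LeviCivita → LeviCivita) : Prop :=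
  IsMeasurableSet A ∧
  if IsBddOn A f then lowerM A f = upperM A f
  else if ∀ x ∈ A, 0 ≤ f x then lowerM A f < ⊤
  else if ∀ x ∈ A, f x ≤ 0 then MIntegrableNonneg A (negPart f)
  else MIntegrableNonneg A (posPart f) ∧ MIntegrableNonneg A (negPart f)

open Classical in
/-- The M-integral of an M-integrable function over a measurable set, in the same four cases. -/
def mIntegral (A : Set LeviCivita) (f : LeviCivita → LeviCivita) : EReal :=
  if IsBddOn A f then lowerM A f
  else if ∀ x ∈ A, 0 ≤ f x then lowerM A f
  else if ∀ x ∈ A, f x ≤ 0 then -lowerM A (negPart f)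
  else lowerM A (posPart f) - lowerM A (negPart f)

/-- `f` is M-integrable over the set of finite elements, with M-integral `v ∈ ℝ`: the M-integrals
over `[-t, t]` tend to `v` as the real number `t` tends to infinity. -/
def HasMIntegralFin (f : LeviCivita → LeviCivita) (v : ℝ) : Prop :=
  (∀ᶠ t : ℝ in atTop, MIntegrable (Set.Icc (ofReal (-t)) (ofReal t)) f) ∧
  Tendsto (fun t : ℝ => mIntegral (Set.Icc (ofReal (-t)) (ofReal t)) f) atTop (𝓝 (v : EReal))

/-! ### Dirac-like functions and the extension of order zero -/

/-- The function `δ` on the finite elements (its values elsewhere are irrelevant) is M-integrable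
and Dirac-like at `r`. -/
structure IsDiracLike (δ : LeviCivita → LeviCivita) (r : LeviCivita) : Prop where
  mem_finite : r ∈ finiteSet
  nonneg : ∀ x ∈ finiteSet, 0 ≤ δ x
  support_subset : ∃ h : LeviCivita, 0 < h ∧ IsInfinitesimal h ∧
    {x ∈ finiteSet | δ x ≠ 0} ⊆ Set.Icc (r - h) (r + h) ∧ Set.Icc (r - h) (r + h) ⊆ finiteSet
  integral_eq_one : HasMIntegralFin δ 1

/-- The extension of order zero of `f : ℝ → ℝ`: it takes the value `f r` at `r + ε`, for `r` real and
`ε` infinitesimal. (Only its values at finite elements matter.) -/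
def ext0 (f : ℝ → ℝ) (x : LeviCivita) : LeviCivita := ofReal (f (sh x).toReal)

end LeviCivita

end

/-!
All points of the support of `δ` lie infinitely close to `r`, hence have the same standard part as
`r`. On that support `ext₀ f` is therefore constant, so `δ · ext₀ f` and the real multiple
`f(°r) · δ` agree on the finite elements, and everything rests on the homogeneity of the M-integral.
Real scalars pass through each layer of its definition; a negative scalar exchanges the lower and
upper values, and the scalar `0` needs the existence of a non-negative function with a finite
M-integral, which forces the lower value of the zero function to be `0`.
-/

namespace LeviCivita

/-! ### Scalar multiplication in the extended reals and in ordered modules -/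

theorem map_smul_eq_coe_mul_of_forall_le {E : Type*} [MulAction ℝ E] {φ : E → EReal}
    (h : ∀ c : ℝ, 0 < c → ∀ x, (c : EReal) * φ x ≤ φ (c • x)) {c : ℝ} (hc : 0 < c) (x : E) :
    φ (c • x) = c * φ x := by
  refine le_antisymm ?_ (h c hc x)
  have hinv : (c⁻¹ : ℝ) * φ (c • x) ≤ φ x := by
    simpa only [inv_smul_smul₀ hc.ne'] using h c⁻¹ (inv_pos.2 hc) (c • x)
  calc φ (c • x) = c * ((c⁻¹ : ℝ) * φ (c • x)) := by
        rw [← mul_assoc, ← EReal.coe_mul, mul_inv_cancel₀ hc.ne', EReal.coe_one, one_mul]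
    _ ≤ c * φ x := mul_le_mul_of_nonneg_left hinv (EReal.coe_nonneg.2 hc.le)

theorem coe_mul_sSup_le {c : ℝ} (hc : 0 < c) {S : Set EReal} {z : EReal}
    (h : ∀ a ∈ S, c * a ≤ z) : c * sSup S ≤ z := by
  have hc' : (0 : EReal) < c := EReal.coe_pos.2 hc
  rw [mul_comm, ← EReal.le_div_iff_mul_le hc' (EReal.coe_ne_top c)]
  refine sSup_le fun a ha => ?_
  rw [EReal.le_div_iff_mul_le hc' (EReal.coe_ne_top c), mul_comm]
  exact h a ha

theorem coe_mul_lt_top_iff {c : ℝ} (hc : 0 < c) {z : EReal} : c * z < ⊤ ↔ z < ⊤ := by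
  induction z with
  | bot => simp [EReal.coe_mul_bot_of_pos hc]
  | coe a => simp [← EReal.coe_mul, EReal.coe_lt_top]
  | top => simp [EReal.coe_mul_top_of_pos hc]

theorem coe_mul_right_inj {c : ℝ} (hc : c ≠ 0) {y z : EReal} :
    (c : EReal) * y = c * z ↔ y = z := by
  refine ⟨fun h => ?_, congrArg _⟩
  have hinv := congrArg ((c⁻¹ : ℝ) * · : EReal → EReal) h
  simpa only [← mul_assoc, ← EReal.coe_mul, inv_mul_cancel₀ hc, EReal.coe_one, one_mul]
    using hinv

theorem sub_eq_coe_neg_of_sub_eq_coe {y z : EReal} {a : ℝ} (h : y - z = a) :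
    z - y = (-a : ℝ) := by
  have hbot : y ≠ ⊥ ∨ z ≠ ⊥ := by
    by_contra! hyz
    simp [hyz.1] at h
  have htop : y ≠ ⊤ ∨ z ≠ ⊤ := by
    by_contra! hyz
    simp [hyz.1, hyz.2] at h
  rw [EReal.coe_neg, ← h, EReal.neg_sub hbot htop, add_comm, sub_eq_add_neg]

section OrderedModule

variable {E : Type*} [AddCommGroup E] [LinearOrder E] [Module ℝ E] [IsStrictOrderedModule ℝ E]

theorem inv_abs_add_one_smul_pos (c : ℝ) {ε : E} (hε : 0 < ε) :
    0 < (|c| + 1)⁻¹ • ε :=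
  smul_pos (by positivity) hε

variable [IsOrderedAddMonoid E]

theorem abs_smul_le_of_abs_le {c : ℝ} {x ε : E} (h : |x| ≤ (|c| + 1)⁻¹ • ε) :
    |c • x| ≤ ε := by
  have hc : 0 < |c| + 1 := by positivity
  calc |c • x| = |c| • |x| := abs_smul c x
    _ ≤ (|c| + 1) • |x| := smul_le_smul_of_nonneg_right (lt_add_one _).le (abs_nonneg x)
    _ ≤ ε := (le_inv_smul_iff_of_pos hc).1 h

theorem abs_smul_lt_of_abs_lt {c : ℝ} {x ε : E} (h : |x| < (|c| + 1)⁻¹ • ε) :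
    |c • x| < ε := by
  have hc : 0 < |c| + 1 := by positivity
  calc |c • x| = |c| • |x| := abs_smul c x
    _ ≤ (|c| + 1) • |x| := smul_le_smul_of_nonneg_right (lt_add_one _).le (abs_nonneg x)
    _ < ε := (lt_inv_smul_iff_of_pos hc).1 h

end OrderedModule

/-! ### The Levi-Civita field as an ordered real algebra -/

variable {A S : Set LeviCivita} {f g F : LeviCivita → LeviCivita} {v x y l : LeviCivita}

instance : IsStrictOrderedRing LeviCivita :=
  Function.Injective.isStrictOrderedRing
    (fun x : LeviCivita => (toLex x.1 : Lex (HahnSeries ℚ ℝ)))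
    rfl rfl (fun _ _ => rfl) (fun _ _ => rfl) Iff.rfl Iff.rfl

theorem ofReal_strictMono : StrictMono ofReal := by
  intro a b hab
  have coeff_zero (c : ℝ) : (ofReal c).coeff 0 = c := HahnSeries.coeff_single_same 0 c
  refine (lt_iff _ _).2 ⟨0, fun p hp => ?_, by rwa [coeff_zero, coeff_zero]⟩
  exact (HahnSeries.coeff_single_of_ne hp.ne).trans (HahnSeries.coeff_single_of_ne hp.ne).symm

noncomputable instance : Algebra ℝ LeviCivita := ofReal.toAlgebra

instance : IsOrderedModule ℝ LeviCivita :=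
  IsOrderedModule.of_algebraMap_mono ofReal_strictMono.monotone

instance : PosSMulStrictMono ℝ LeviCivita := PosSMulMono.toPosSMulStrictMono

instance : IsStrictOrderedModule ℝ LeviCivita where

theorem coeff_smul (c : ℝ) (x : LeviCivita) (q : ℚ) : (c • x).coeff q = c * x.coeff q :=
  HahnSeries.coeff_single_zero_mul (r := c) (x := x.1)

theorem smul_ofReal (c a : ℝ) : c • ofReal a = ofReal (c * a) :=
  (map_mul ofReal c a).symm

theorem Icc_ofReal_neg_subset_finiteSet (t : ℝ) :
    Set.Icc (ofReal (-t)) (ofReal t) ⊆ finiteSet := fun x hx => by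
  refine ⟨t + 1, (abs_le.2 ⟨?_, hx.2⟩).trans_lt (ofReal_strictMono (lt_add_one t))⟩
  rw [← map_neg]
  exact hx.1

/-! ### The standard part -/

theorem sh_mono : Monotone sh := fun x y hxy => by
  refine sSup_le_sSup ?_
  rintro _ ⟨a, rfl, ha⟩
  exact ⟨a, rfl, ha.trans hxy⟩

theorem sh_ofReal (a : ℝ) : sh (ofReal a) = a := by
  refine le_antisymm (sSup_le ?_) (le_sSup ⟨a, rfl, le_rfl⟩)
  rintro _ ⟨b, rfl, hb⟩
  exact EReal.coe_le_coe_iff.2 (ofReal_strictMono.le_iff_le.1 hb)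

theorem coe_le_sh {a : ℝ} (h : ofReal a ≤ x) : (a : EReal) ≤ sh x :=
  (sh_ofReal a).symm.trans_le (sh_mono h)

theorem sh_le_coe {a : ℝ} (h : x ≤ ofReal a) : sh x ≤ a :=
  (sh_mono h).trans_eq (sh_ofReal a)

theorem sh_neg (x : LeviCivita) : sh (-x) = -sh x := by
  refine le_antisymm (sSup_le ?_) (EReal.ge_of_forall_gt_iff_ge.1 fun a ha => ?_)
  · rintro _ ⟨a, rfl, ha⟩
    rw [EReal.le_neg, ← EReal.coe_neg]
    exact sh_le_coe (by rw [map_neg]; exact le_neg.1 ha)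
  · refine coe_le_sh (le_of_not_gt fun hlt => ha.not_ge ?_)
    rw [EReal.neg_le, ← EReal.coe_neg]
    exact coe_le_sh (by rw [map_neg]; exact (neg_lt.1 hlt).le)

theorem sh_smul_of_pos {c : ℝ} (hc : 0 < c) (x : LeviCivita) : sh (c • x) = c * sh x := by
  refine map_smul_eq_coe_mul_of_forall_le (φ := sh) (fun c hc x => coe_mul_sSup_le hc ?_) hc x
  rintro _ ⟨a, rfl, ha⟩
  rw [← EReal.coe_mul]
  exact coe_le_sh ((smul_ofReal c a).symm.trans_le (smul_le_smul_of_nonneg_left ha hc.le))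

theorem sh_le_sh_of_isInfinitesimal_sub (h : IsInfinitesimal (x - y)) : sh x ≤ sh y := by
  refine sSup_le ?_
  rintro _ ⟨a, rfl, ha⟩
  refine EReal.ge_of_forall_gt_iff_ge.1 fun b hb => coe_le_sh ?_
  have hxy : x - y ≤ ofReal (a - b) :=
    (le_abs_self _).trans (h _ (sub_pos.2 (EReal.coe_lt_coe_iff.1 hb)))
  rw [map_sub] at hxy
  linarith

theorem sh_eq_sh_of_isInfinitesimal_sub (h : IsInfinitesimal (x - y)) : sh x = sh y :=
  le_antisymm (sh_le_sh_of_isInfinitesimal_sub h)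
    (sh_le_sh_of_isInfinitesimal_sub fun s hs => abs_sub_comm x y ▸ h s hs)

/-! ### Homogeneity of the non-Archimedean integral -/

theorem WeakLim.smul {u : ℕ → LeviCivita} (h : WeakLim u l) (c : ℝ) :
    WeakLim (fun k => c • u k) (c • l) := by
  intro ε hε
  have hε' : 0 < (|c| + 1)⁻¹ * ε := by positivity
  have hle : (|c| + 1)⁻¹ * ε ≤ ε :=
    mul_le_of_le_one_left hε.le (inv_le_one_of_one_le₀ (by simp))
  obtain ⟨n, hn⟩ := h _ hε'
  refine ⟨n, fun m hm q hq => ?_⟩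
  have hum := hn m hm q (hq.trans (inv_anti₀ hε' hle))
  calc |(c • u m - c • l).coeff q| = |c| * |(u m - l).coeff q| := by
        rw [← smul_sub, coeff_smul, abs_mul]
    _ ≤ (|c| + 1) * |(u m - l).coeff q| := by gcongr; exact (lt_add_one _).le
    _ < ε := (lt_inv_mul_iff₀ (by positivity)).1 hum

theorem HasStrongSum.smul {u : ℕ → LeviCivita} (h : HasStrongSum u l) (c : ℝ) :
    HasStrongSum (fun k => c • u k) (c • l) := by
  intro ε hε
  obtain ⟨n, hn⟩ := h _ (inv_abs_add_one_smul_pos c hε)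
  refine ⟨n, fun m hm => ?_⟩
  rw [← Finset.smul_sum, ← smul_sub]
  exact abs_smul_lt_of_abs_lt (hn m hm)

theorem IsSimpleOn.smul (h : IsSimpleOn f S) (c : ℝ) : IsSimpleOn (c • f) S := by
  obtain ⟨a, x₀, ha⟩ := h
  refine ⟨c • a, x₀, fun x hx => ?_⟩
  simpa only [Pi.smul_apply, smul_mul_assoc, ← Finset.smul_sum] using (ha x hx).smul c

theorem HasDerivOn.smul (h : HasDerivOn F f S) (c : ℝ) : HasDerivOn (c • F) (c • f) S := by
  intro x hx ε hε
  obtain ⟨η, hη, hF⟩ := h x hx _ (inv_abs_add_one_smul_pos c hε)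
  refine ⟨η, hη, fun y hy hyx => ?_⟩
  simp only [Pi.smul_apply, smul_mul_assoc, ← smul_sub]
  exact abs_smul_le_of_abs_le (by simpa only [smul_mul_assoc] using hF y hy hyx)

theorem HasLimWithin.smul (h : HasLimWithin F S x l) (c : ℝ) :
    HasLimWithin (c • F) S x (c • l) := by
  intro ε hε
  obtain ⟨η, hη, hF⟩ := h _ (inv_abs_add_one_smul_pos c hε)
  refine ⟨η, hη, fun y hy hyx => ?_⟩
  rw [Pi.smul_apply, ← smul_sub]
  exact abs_smul_lt_of_abs_lt (hF y hy hyx)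

theorem HasSimpleIntegral.smul {I : BddInterval} (h : HasSimpleIntegral I f v) (c : ℝ) :
    HasSimpleIntegral I (c • f) (c • v) := by
  rcases h with ⟨hI, rfl⟩ | ⟨hI, F, la, lb, hF, hderiv, hla, hlb, rfl⟩
  · exact Or.inl ⟨hI, smul_zero c⟩
  · exact Or.inr ⟨hI, c • F, c • la, c • lb, hF.smul c, hderiv.smul c, hla.smul c, hlb.smul c,
      smul_sub c lb la⟩

theorem isSimpleOn_zero (S : Set LeviCivita) : IsSimpleOn 0 S :=
  ⟨0, 0, fun _ _ ε hε => ⟨0, fun _ _ q _ => by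
    simpa [show coeff 0 q = 0 from rfl] using hε⟩⟩

theorem hasLimWithin_zero (S : Set LeviCivita) (x : LeviCivita) : HasLimWithin 0 S x 0 :=
  fun ε hε => ⟨1, one_pos, fun y _ _ => by simpa using hε⟩

theorem hasDerivOn_zero (S : Set LeviCivita) : HasDerivOn 0 0 S :=
  fun x _ ε hε => ⟨1, one_pos, fun y _ _ => by
    simpa using mul_nonneg hε.le (abs_nonneg (y - x))⟩

theorem hasSimpleIntegral_zero (I : BddInterval) : HasSimpleIntegral I 0 0 := by
  rcases I.left_le_right.eq_or_lt with hI | hI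
  · exact Or.inl ⟨hI, rfl⟩
  · exact Or.inr ⟨hI, 0, 0, 0, isSimpleOn_zero _, hasDerivOn_zero _, hasLimWithin_zero _ _,
      hasLimWithin_zero _ _, (sub_zero 0).symm⟩

theorem isMeasurableFun_zero {m : LeviCivita} (hm : HasMeasure A m) : IsMeasurableFun A 0 := by
  refine ⟨m, hm, fun ε hε => ?_⟩
  obtain ⟨s, ⟨I, hI, hs⟩, hms⟩ := (lt_isLUB_iff hm.2.1).1 (sub_lt_self m hε)
  exact ⟨I, s, hI, hs, sub_lt_comm.1 hms, fun n => isSimpleOn_zero _⟩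

theorem hasIntegral_zero {m : LeviCivita} (hm : HasMeasure A m) : HasIntegral A 0 0 := by
  have hasStrongSum_zero : HasStrongSum 0 0 := fun ε hε => ⟨0, fun _ _ => by simpa using hε⟩
  refine ⟨isMeasurableFun_zero hm, m, hm, fun ε hε => ⟨1, one_pos, fun I s _ _ _ _ => ?_⟩⟩
  exact ⟨0, 0, fun n => hasSimpleIntegral_zero (I n), hasStrongSum_zero, by simpa using hε⟩

theorem memL1_zero {m : LeviCivita} (hm : HasMeasure A m) : MemL1 A 0 := by
  have habs : (fun x => |(0 : LeviCivita → LeviCivita) x|) = 0 := funext fun _ => abs_zero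
  exact ⟨isMeasurableFun_zero hm, 0, habs.symm ▸ hasIntegral_zero hm⟩

theorem IsMeasurableFun.smul (h : IsMeasurableFun A f) (c : ℝ) : IsMeasurableFun A (c • f) := by
  obtain ⟨m, hm, hf⟩ := h
  refine ⟨m, hm, fun ε hε => ?_⟩
  obtain ⟨I, s, hI, hs, hms, hsimple⟩ := hf ε hε
  exact ⟨I, s, hI, hs, hms, fun n => (hsimple n).smul c⟩

theorem HasIntegral.smul (h : HasIntegral A f v) (c : ℝ) : HasIntegral A (c • f) (c • v) := by
  obtain ⟨hf, m, hm, hlim⟩ := h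
  rcases eq_or_ne c 0 with rfl | hc
  · simpa only [zero_smul] using hasIntegral_zero hm
  refine ⟨hf.smul c, m, hm, fun ε hε => ?_⟩
  obtain ⟨η, hη, hsum⟩ := hlim _ (inv_abs_add_one_smul_pos c hε)
  refine ⟨η, hη, fun I s hI hsimple hs hms => ?_⟩
  have hsimple' (n : ℕ) : IsSimpleOn f (I n).toSet := by
    simpa only [inv_smul_smul₀ hc] using (hsimple n).smul c⁻¹
  obtain ⟨w, W, hw, hW, hWv⟩ := hsum I s hI hsimple' hs hms
  refine ⟨fun n => c • w n, c • W, fun n => (hw n).smul c, hW.smul c, ?_⟩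
  rw [← smul_sub]
  exact abs_smul_lt_of_abs_lt hWv

theorem MemL1.smul (h : MemL1 A f) (c : ℝ) : MemL1 A (c • f) := by
  obtain ⟨hf, v, hv⟩ := h
  have habs : (fun x => |(c • f) x|) = |c| • fun x => |f x| := funext fun x => abs_smul c (f x)
  exact ⟨hf.smul c, |c| • v, habs ▸ hv.smul |c|⟩

theorem HasIntegral.neg (h : HasIntegral A f v) : HasIntegral A (-f) (-v) := by
  simpa only [neg_smul, one_smul] using h.smul (-1)

theorem MemL1.neg (h : MemL1 A f) : MemL1 A (-f) := by
  simpa only [neg_smul, one_smul] using h.smul (-1)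

/-! ### The lower and upper values -/

theorem sh_le_lowerM (hg : MemL1 A g) (hgf : ∀ x ∈ A, g x ≤ f x) (hv : HasIntegral A g v) :
    sh v ≤ lowerM A f :=
  le_sSup ⟨g, v, hg, hgf, hv, rfl⟩

theorem upperM_le_sh (hg : MemL1 A g) (hfg : ∀ x ∈ A, f x ≤ g x) (hv : HasIntegral A g v) :
    upperM A f ≤ sh v :=
  sInf_le ⟨g, v, hg, hfg, hv, rfl⟩

theorem lowerM_mono (hfg : ∀ x ∈ A, f x ≤ g x) : lowerM A f ≤ lowerM A g := by
  refine sSup_le ?_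
  rintro _ ⟨k, v, hk, hkf, hv, rfl⟩
  exact sh_le_lowerM hk (fun x hx => (hkf x hx).trans (hfg x hx)) hv

theorem lowerM_neg (A : Set LeviCivita) (f : LeviCivita → LeviCivita) :
    lowerM A (-f) = -upperM A f := by
  refine le_antisymm (sSup_le ?_) ?_
  · rintro _ ⟨g, v, hg, hgf, hv, rfl⟩
    rw [EReal.le_neg, ← sh_neg]
    exact upperM_le_sh hg.neg (fun x hx => le_neg.1 (hgf x hx)) hv.neg
  · rw [EReal.neg_le]
    refine le_sInf ?_
    rintro _ ⟨g, v, hg, hfg, hv, rfl⟩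
    rw [EReal.neg_le, ← sh_neg]
    exact sh_le_lowerM hg.neg (fun x hx => neg_le_neg (hfg x hx)) hv.neg

theorem upperM_neg (A : Set LeviCivita) (f : LeviCivita → LeviCivita) :
    upperM A (-f) = -lowerM A f := by
  rw [← neg_eq_iff_eq_neg, ← lowerM_neg, neg_neg]

theorem lowerM_congr (hfg : Set.EqOn f g A) : lowerM A f = lowerM A g :=
  le_antisymm (lowerM_mono fun _ hx => (hfg hx).le) (lowerM_mono fun _ hx => (hfg hx).ge)

theorem upperM_congr (hfg : Set.EqOn f g A) : upperM A f = upperM A g := by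
  rw [← neg_inj, ← lowerM_neg, ← lowerM_neg]
  exact lowerM_congr fun x hx => congrArg Neg.neg (hfg hx)

theorem lowerM_smul_of_pos (A : Set LeviCivita) {c : ℝ} (hc : 0 < c)
    (f : LeviCivita → LeviCivita) : lowerM A (c • f) = c * lowerM A f := by
  refine map_smul_eq_coe_mul_of_forall_le (φ := lowerM A)
    (fun c hc f => coe_mul_sSup_le hc ?_) hc f
  rintro _ ⟨g, v, hg, hgf, hv, rfl⟩
  rw [← sh_smul_of_pos hc]
  exact sh_le_lowerM (hg.smul c) (fun x hx => smul_le_smul_of_nonneg_left (hgf x hx) hc.le)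
    (hv.smul c)

theorem upperM_smul_of_pos (A : Set LeviCivita) {c : ℝ} (hc : 0 < c)
    (f : LeviCivita → LeviCivita) : upperM A (c • f) = c * upperM A f := by
  rw [← neg_inj, ← lowerM_neg, ← smul_neg, lowerM_smul_of_pos A hc, lowerM_neg, mul_neg]

theorem exists_hasMeasure_of_lowerM_ne_bot (h : lowerM A f ≠ ⊥) : ∃ m, HasMeasure A m := by
  contrapose! h
  refine sSup_eq_bot.2 ?_
  rintro _ ⟨g, v, ⟨⟨m, hm, -⟩, -⟩, -⟩
  exact (h m hm).elim

theorem lowerM_zero_of_nonneg (hf : ∀ x ∈ A, 0 ≤ f x) (hbot : lowerM A f ≠ ⊥)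
    (htop : lowerM A f ≠ ⊤) : lowerM A 0 = 0 := by
  obtain ⟨m, hm⟩ := exists_hasMeasure_of_lowerM_ne_bot hbot
  have hnonneg : 0 ≤ lowerM A 0 := by
    simpa only [← map_zero ofReal, sh_ofReal, EReal.coe_zero] using
      sh_le_lowerM (memL1_zero hm) (fun _ _ => le_rfl) (hasIntegral_zero hm)
  have hlt : lowerM A 0 < ⊤ := (lowerM_mono hf).trans_lt htop.lt_top
  have hdouble : lowerM A 0 = (2 : ℝ) * lowerM A 0 := by
    rw [← lowerM_smul_of_pos A two_pos, smul_zero]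
  lift lowerM A 0 to ℝ using ⟨hlt.ne, (EReal.bot_lt_zero.trans_le hnonneg).ne'⟩ with L
  rw [← EReal.coe_mul, EReal.coe_eq_coe_iff] at hdouble
  exact_mod_cast (by linarith : L = 0)

/-! ### Homogeneity of the M-integral -/

theorem isBddOn_congr (hfg : Set.EqOn f g A) : IsBddOn A f ↔ IsBddOn A g :=
  exists_congr fun _ => forall₂_congr fun _ hx => by rw [hfg hx]

theorem isBddOn_neg : IsBddOn A (-f) ↔ IsBddOn A f := by
  simp only [IsBddOn, Pi.neg_apply, abs_neg]

theorem IsBddOn.smul (h : IsBddOn A f) (c : ℝ) : IsBddOn A (c • f) := by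
  obtain ⟨M, hM⟩ := h
  refine ⟨|c| • M, fun x hx => ?_⟩
  rw [Pi.smul_apply, abs_smul]
  exact smul_le_smul_of_nonneg_left (hM x hx) (abs_nonneg c)

theorem isBddOn_smul_iff {c : ℝ} (hc : c ≠ 0) : IsBddOn A (c • f) ↔ IsBddOn A f :=
  ⟨fun h => by simpa only [inv_smul_smul₀ hc] using h.smul c⁻¹, fun h => h.smul c⟩

theorem isBddOn_of_nonneg_of_nonpos (hnonneg : ∀ x ∈ A, 0 ≤ f x) (hnonpos : ∀ x ∈ A, f x ≤ 0) :
    IsBddOn A f :=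
  ⟨0, fun x hx => by rw [(hnonpos x hx).antisymm (hnonneg x hx), abs_zero]⟩

theorem posPart_neg (f : LeviCivita → LeviCivita) : posPart (-f) = negPart f := rfl

theorem negPart_neg (f : LeviCivita → LeviCivita) : negPart (-f) = posPart f := by
  rw [← posPart_neg, neg_neg]

theorem posPart_smul_of_nonneg {c : ℝ} (hc : 0 ≤ c) (f : LeviCivita → LeviCivita) :
    posPart (c • f) = c • posPart f := funext fun x => by
  simp only [posPart, Pi.smul_apply, (monotone_smul_left_of_nonneg hc).map_max, smul_zero]

theorem negPart_smul_of_nonneg {c : ℝ} (hc : 0 ≤ c) (f : LeviCivita → LeviCivita) :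
    negPart (c • f) = c • negPart f := by
  rw [← posPart_neg, ← smul_neg, posPart_smul_of_nonneg hc, posPart_neg]

theorem eqOn_negPart_of_nonpos (hf : ∀ x ∈ A, f x ≤ 0) : Set.EqOn (negPart f) (-f) A :=
  fun x hx => max_eq_left (neg_nonneg.2 (hf x hx))

theorem mIntegrableNonneg_congr (hfg : Set.EqOn f g A) :
    MIntegrableNonneg A f ↔ MIntegrableNonneg A g := by
  simp only [MIntegrableNonneg, isBddOn_congr hfg, lowerM_congr hfg, upperM_congr hfg]

theorem mIntegrableNonneg_smul_iff {c : ℝ} (hc : 0 < c) :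
    MIntegrableNonneg A (c • f) ↔ MIntegrableNonneg A f := by
  simp only [MIntegrableNonneg, isBddOn_smul_iff hc.ne', lowerM_smul_of_pos A hc,
    upperM_smul_of_pos A hc, coe_mul_right_inj hc.ne', coe_mul_lt_top_iff hc]

theorem mIntegrableNonneg_iff_lowerM_lt_top (hb : ¬IsBddOn A f) :
    MIntegrableNonneg A f ↔ lowerM A f < ⊤ := by
  simp only [MIntegrableNonneg, hb, false_and, false_or, not_false_eq_true, true_and]

/-- `f` is M-integrable over `A` and its M-integral is the real number `a`; requiring `a` to be real
excludes the infinite values that `mIntegral` can take. -/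
def HasMIntegral (A : Set LeviCivita) (f : LeviCivita → LeviCivita) (a : ℝ) : Prop :=
  MIntegrable A f ∧ mIntegral A f = a

variable {a : ℝ}

theorem HasMIntegral.congr (h : HasMIntegral A f a) (hfg : Set.EqOn f g A) :
    HasMIntegral A g a := by
  have hnonneg : (∀ x ∈ A, 0 ≤ f x) ↔ ∀ x ∈ A, 0 ≤ g x :=
    forall₂_congr fun x hx => by rw [hfg hx]
  have hnonpos : (∀ x ∈ A, f x ≤ 0) ↔ ∀ x ∈ A, g x ≤ 0 :=
    forall₂_congr fun x hx => by rw [hfg hx]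
  have hpos : Set.EqOn (posPart f) (posPart g) A := fun x hx => by simp only [posPart, hfg hx]
  have hneg : Set.EqOn (negPart f) (negPart g) A := fun x hx => by simp only [negPart, hfg hx]
  rwa [HasMIntegral, MIntegrable, mIntegral, isBddOn_congr hfg, hnonneg, hnonpos,
    lowerM_congr hfg, upperM_congr hfg, mIntegrableNonneg_congr hpos,
    mIntegrableNonneg_congr hneg, lowerM_congr hpos, lowerM_congr hneg] at h

theorem HasMIntegral.smul_of_pos (h : HasMIntegral A f a) {c : ℝ} (hc : 0 < c) :
    HasMIntegral A (c • f) (c * a) := by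
  have hnonneg : (∀ x ∈ A, 0 ≤ (c • f) x) ↔ ∀ x ∈ A, 0 ≤ f x :=
    forall₂_congr fun x _ => smul_nonneg_iff_nonneg_of_pos_left hc
  have hnonpos : (∀ x ∈ A, (c • f) x ≤ 0) ↔ ∀ x ∈ A, f x ≤ 0 :=
    forall₂_congr fun x _ => smul_nonpos_iff_nonpos_of_pos_left hc
  constructor
  · rw [MIntegrable, isBddOn_smul_iff hc.ne', hnonneg, hnonpos, lowerM_smul_of_pos A hc,
      upperM_smul_of_pos A hc, coe_mul_right_inj hc.ne', coe_mul_lt_top_iff hc,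
      posPart_smul_of_nonneg hc.le, negPart_smul_of_nonneg hc.le, mIntegrableNonneg_smul_iff hc,
      mIntegrableNonneg_smul_iff hc]
    exact h.1
  · rw [EReal.coe_mul, ← h.2, mIntegral, mIntegral, isBddOn_smul_iff hc.ne', hnonneg, hnonpos,
      lowerM_smul_of_pos A hc, posPart_smul_of_nonneg hc.le, negPart_smul_of_nonneg hc.le,
      lowerM_smul_of_pos A hc, lowerM_smul_of_pos A hc, ← mul_neg,
      ← EReal.mul_sub_of_nonneg_of_ne_top (EReal.coe_nonneg.2 hc.le) (EReal.coe_ne_top c)]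
    simp only [mul_ite]

theorem hasMIntegral_iff_of_isBddOn (hb : IsBddOn A f) :
    HasMIntegral A f a ↔ IsMeasurableSet A ∧ lowerM A f = a ∧ upperM A f = a := by
  rw [HasMIntegral, MIntegrable, mIntegral, if_pos hb, if_pos hb]
  exact ⟨fun ⟨⟨hA, hLU⟩, hL⟩ => ⟨hA, hL, hLU ▸ hL⟩,
    fun ⟨hA, hL, hU⟩ => ⟨⟨hA, hL.trans hU.symm⟩, hL⟩⟩

theorem hasMIntegral_iff_of_nonneg (hb : ¬IsBddOn A f) (hge : ∀ x ∈ A, 0 ≤ f x) :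
    HasMIntegral A f a ↔ IsMeasurableSet A ∧ lowerM A f = a := by
  rw [HasMIntegral, MIntegrable, mIntegral, if_neg hb, if_neg hb, if_pos hge, if_pos hge]
  exact ⟨fun ⟨⟨hA, _⟩, hL⟩ => ⟨hA, hL⟩, fun ⟨hA, hL⟩ => ⟨⟨hA, hL ▸ EReal.coe_lt_top a⟩, hL⟩⟩

theorem hasMIntegral_iff_of_nonpos (hb : ¬IsBddOn A f) (hle : ∀ x ∈ A, f x ≤ 0) :
    HasMIntegral A f a ↔ IsMeasurableSet A ∧ upperM A f = a := by
  have hge : ¬∀ x ∈ A, 0 ≤ f x := fun hge => hb (isBddOn_of_nonneg_of_nonpos hge hle)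
  have hneg := eqOn_negPart_of_nonpos hle
  rw [HasMIntegral, MIntegrable, mIntegral, if_neg hb, if_neg hb, if_neg hge, if_neg hge,
    if_pos hle, if_pos hle, mIntegrableNonneg_congr hneg,
    mIntegrableNonneg_iff_lowerM_lt_top (isBddOn_neg.not.2 hb), lowerM_congr hneg,
    lowerM_neg, neg_neg]
  refine ⟨fun ⟨⟨hA, _⟩, hU⟩ => ⟨hA, hU⟩, fun ⟨hA, hU⟩ => ⟨⟨hA, ?_⟩, hU⟩⟩
  exact hU ▸ EReal.coe_lt_top (-a)

theorem hasMIntegral_iff_of_not_nonneg_of_not_nonpos (hb : ¬IsBddOn A f)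
    (hge : ¬∀ x ∈ A, 0 ≤ f x) (hle : ¬∀ x ∈ A, f x ≤ 0) :
    HasMIntegral A f a ↔ IsMeasurableSet A ∧ MIntegrableNonneg A (posPart f) ∧
      MIntegrableNonneg A (negPart f) ∧ lowerM A (posPart f) - lowerM A (negPart f) = a := by
  rw [HasMIntegral, MIntegrable, mIntegral, if_neg hb, if_neg hb, if_neg hge, if_neg hge,
    if_neg hle, if_neg hle, and_assoc, and_assoc]

theorem HasMIntegral.neg (h : HasMIntegral A f a) : HasMIntegral A (-f) (-a) := by
  have hge_neg : (∀ x ∈ A, 0 ≤ (-f) x) ↔ ∀ x ∈ A, f x ≤ 0 := forall₂_congr fun _ _ => neg_nonneg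
  have hle_neg : (∀ x ∈ A, (-f) x ≤ 0) ↔ ∀ x ∈ A, 0 ≤ f x := forall₂_congr fun _ _ => neg_nonpos
  by_cases hb : IsBddOn A f
  · obtain ⟨hA, hL, hU⟩ := (hasMIntegral_iff_of_isBddOn hb).1 h
    refine (hasMIntegral_iff_of_isBddOn (isBddOn_neg.2 hb)).2 ⟨hA, ?_, ?_⟩
    · rw [lowerM_neg, hU, EReal.coe_neg]
    · rw [upperM_neg, hL, EReal.coe_neg]
  have hb' : ¬IsBddOn A (-f) := isBddOn_neg.not.2 hb
  by_cases hge : ∀ x ∈ A, 0 ≤ f x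
  · obtain ⟨hA, hL⟩ := (hasMIntegral_iff_of_nonneg hb hge).1 h
    refine (hasMIntegral_iff_of_nonpos hb' (hle_neg.2 hge)).2 ⟨hA, ?_⟩
    rw [upperM_neg, hL, EReal.coe_neg]
  by_cases hle : ∀ x ∈ A, f x ≤ 0
  · obtain ⟨hA, hU⟩ := (hasMIntegral_iff_of_nonpos hb hle).1 h
    refine (hasMIntegral_iff_of_nonneg hb' (hge_neg.2 hle)).2 ⟨hA, ?_⟩
    rw [lowerM_neg, hU, EReal.coe_neg]
  · obtain ⟨hA, hpos, hneg, hsub⟩ := (hasMIntegral_iff_of_not_nonneg_of_not_nonpos hb hge hle).1 h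
    rw [hasMIntegral_iff_of_not_nonneg_of_not_nonpos hb' (hge_neg.not.2 hle)
      (hle_neg.not.2 hge), posPart_neg, negPart_neg]
    exact ⟨hA, hneg, hpos, sub_eq_coe_neg_of_sub_eq_coe hsub⟩

theorem HasMIntegral.zero_of_nonneg (h : HasMIntegral A f a) (hf : ∀ x ∈ A, 0 ≤ f x) :
    HasMIntegral A 0 0 := by
  have ⟨hA, hL⟩ : IsMeasurableSet A ∧ lowerM A f = a := by
    by_cases hb : IsBddOn A f
    · obtain ⟨hA, hL, -⟩ := (hasMIntegral_iff_of_isBddOn hb).1 h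
      exact ⟨hA, hL⟩
    · exact (hasMIntegral_iff_of_nonneg hb hf).1 h
  have hL₀ : lowerM A 0 = 0 :=
    lowerM_zero_of_nonneg hf (hL ▸ EReal.coe_ne_bot a) (hL ▸ EReal.coe_ne_top a)
  have hU₀ : upperM A 0 = 0 := by rw [← neg_zero, upperM_neg, hL₀, neg_zero]
  exact (hasMIntegral_iff_of_isBddOn ⟨0, fun _ _ => abs_zero.le⟩).2 ⟨hA, hL₀, hU₀⟩

theorem HasMIntegral.smul_of_forall_nonneg (h : HasMIntegral A f a) (hf : ∀ x ∈ A, 0 ≤ f x)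
    (c : ℝ) : HasMIntegral A (c • f) (c * a) := by
  rcases lt_trichotomy c 0 with hc | rfl | hc
  · simpa only [neg_smul, neg_mul, neg_neg] using (h.smul_of_pos (neg_pos.2 hc)).neg
  · simpa only [zero_smul, zero_mul] using h.zero_of_nonneg hf
  · exact h.smul_of_pos hc

theorem hasMIntegralFin_iff_exists_tendsto : HasMIntegralFin f a ↔ ∃ b : ℝ → ℝ,
    (∀ᶠ t in atTop, HasMIntegral (Set.Icc (ofReal (-t)) (ofReal t)) f (b t)) ∧
      Tendsto b atTop (𝓝 a) := by
  constructor
  · rintro ⟨hint, hlim⟩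
    refine ⟨fun t => (mIntegral (Set.Icc (ofReal (-t)) (ofReal t)) f).toReal, ?_, ?_⟩
    · filter_upwards [hint, hlim.eventually_ne (EReal.coe_ne_bot a),
        hlim.eventually_ne (EReal.coe_ne_top a)] with t ht hbot htop
      exact ⟨ht, (EReal.coe_toReal htop hbot).symm⟩
    · exact (EReal.tendsto_toReal (EReal.coe_ne_top a) (EReal.coe_ne_bot a)).comp hlim
  · rintro ⟨b, hb, hlim⟩
    refine ⟨hb.mono fun t ht => ht.1, ?_⟩
    exact (EReal.tendsto_coe.2 hlim).congr' (hb.mono fun t ht => ht.2.symm)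

theorem HasMIntegralFin.congr (h : HasMIntegralFin f a) (hfg : Set.EqOn f g finiteSet) :
    HasMIntegralFin g a := by
  obtain ⟨b, hb, hlim⟩ := hasMIntegralFin_iff_exists_tendsto.1 h
  exact hasMIntegralFin_iff_exists_tendsto.2 ⟨b,
    hb.mono fun t ht => ht.congr (hfg.mono (Icc_ofReal_neg_subset_finiteSet t)), hlim⟩

theorem HasMIntegralFin.smul_of_forall_nonneg (h : HasMIntegralFin f a)
    (hf : ∀ x ∈ finiteSet, 0 ≤ f x) (c : ℝ) : HasMIntegralFin (c • f) (c * a) := by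
  obtain ⟨b, hb, hlim⟩ := hasMIntegralFin_iff_exists_tendsto.1 h
  refine hasMIntegralFin_iff_exists_tendsto.2
    ⟨fun t => c * b t, hb.mono fun t ht => ?_, hlim.const_mul c⟩
  exact ht.smul_of_forall_nonneg (fun x hx => hf x (Icc_ofReal_neg_subset_finiteSet t hx)) c

/-! ### Dirac-like functions -/

theorem IsDiracLike.sh_eq {δ : LeviCivita → LeviCivita} {r : LeviCivita} (hδ : IsDiracLike δ r)
    (hx : x ∈ finiteSet) (hδx : δ x ≠ 0) : sh x = sh r := by
  obtain ⟨h, -, hinf, hsupp, -⟩ := hδ.support_subset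
  have hxr : |r - x| ≤ h := Set.mem_Icc_iff_abs_le.2 (hsupp ⟨hx, hδx⟩)
  exact (sh_eq_sh_of_isInfinitesimal_sub fun s hs =>
    hxr.trans ((le_abs_self h).trans (hinf s hs))).symm

theorem IsDiracLike.eqOn_smul_mul_ext0 {δ : LeviCivita → LeviCivita} {r : LeviCivita}
    (hδ : IsDiracLike δ r) (f : ℝ → ℝ) :
    Set.EqOn (f (sh r).toReal • δ) (fun x => δ x * ext0 f x) finiteSet := fun x hx => by
  by_cases hδx : δ x = 0
  · simp only [Pi.smul_apply, hδx, smul_zero, zero_mul]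
  · simp only [Pi.smul_apply, Algebra.smul_def, ext0, hδ.sh_eq hx hδx]
    exact mul_comm _ _

end LeviCivita

theorem mainTheorem10_general (r : LeviCivita) (δ : LeviCivita → LeviCivita)
    (hδ : LeviCivita.IsDiracLike δ r) (f : ℝ → ℝ) :
    LeviCivita.HasMIntegralFin (fun x => δ x * LeviCivita.ext0 f x)
      (f (LeviCivita.sh r).toReal) := by
  have hsmul := hδ.integral_eq_one.smul_of_forall_nonneg hδ.nonneg (f (LeviCivita.sh r).toReal)
  rw [mul_one] at hsmul
  exact hsmul.congr (hδ.eqOn_smul_mul_ext0 f)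

theorem mainTheorem10 (r : ℝ) (δ : LeviCivita → LeviCivita)
    (hδ : LeviCivita.IsDiracLike δ (LeviCivita.ofReal r))
    (f : ℝ → ℝ) (hf : Continuous f) :
    LeviCivita.HasMIntegralFin (fun x => δ x * LeviCivita.ext0 f x) (f r) := by
  simpa only [LeviCivita.sh_ofReal, EReal.toReal_coe] using
    mainTheorem10_general (LeviCivita.ofReal r) δ hδ f
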